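/- **Definitions.** All algebras are non-empty. An *I-algebra* is an algebra $\langle A,\supset,\neg\rangle$ satisfying (I1) $(x\supset x)\supset y\approx y$; (I2) $x\supset(y\supset z)\approx(x\supset y)\supset(x\supset z)\approx y\supset(x\supset z)$; (I3) $((x\supset y)\supset x)\supset x\approx x\supset x$; (I4) $x\supset(\neg y\supset z)\approx\neg(x\supset y)\supset z$; (I5) $\neg\neg x\approx x$; (I6) $p(x,y,x)\approx p(x,y,y)$, where $p(x,y,z)=(x\supset y)\supset((y\supset x)\supset((\neg x\supset\neg y)\supset((\neg y\supset\neg x)\supset z)))$. Write $E(a)$ for $a=a\supset a$, and $a\sim b$ if $E(a\supset b)$ and $E(b\supset a)$. The relation $\sim$ is an equivalence relation, and the operations $[a]\supset[b]=[a\supset b]$, $[a]\wedge[b]=[\neg(a\supset\neg b)]$, $[a]\vee[b]=([a]\supset[b])\supset[b]$ are well defined on $A/{\sim}$. A *Tarski algebra* is an algebra $\langle L,\supset\rangle$ satisfying $(x\supset y)\supset x\approx x$, $x\supset(y\supset z)\approx y\supset(x\supset z)$ and $(x\supset y)\supset y\approx(y\supset x)\supset x$. A *classical implicative lattice* is a relatively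 complemented distributive lattice $\langle L,\sqcap,\sqcup,\backslash\rangle$ with a maximum $1$, where $a\backslash b$ is the relative complement of $a$ in $[a\sqcap b,1]$. An *implicative bilattice* is an algebra $\langle B,\wedge,\vee,\otimes,\oplus,\supset,\neg\rangle$ such that $\langle B,\wedge,\vee\rangle$ and $\langle B,\otimes,\oplus\rangle$ are lattices (with orders $\le_t$ and $\le_k$), $\neg$ is an involution that reverses $\le_t$ and preserves $\le_k$, and (IB1) $(x\supset x)\supset y\approx y$; (IB2) $x\supset(y\supset z)\approx(x\wedge y)\supset z\approx(x\otimes y)\supset z$; (IB3) $((x\supset y)\supset x)\supset x\approx x\supset x$; (IB4) $(x\vee y)\supset z\approx(x\supset z)\wedge(y\supset z)\approx(x\oplus y)\supset z$; (IB5) $x\wedge((x\supset y)\supset(x\otimes y))\approx x$; (IB6) $\neg(x\supset y)\supset z\approx(x\wedge\neg y)\supset z$. For a classical implicative lattice $L$, the algebra $\langle L\odot L,\supset\rangle$ has universe $L\times L$ and operations $\langle a_1,a_2\rangle\wedge\langle b_1,b_2\rangle=\langle a_1\sqcap b_1,a_2\sqcup b_2\rangle$, $\langle a_1,a_2\rangle\vee\langle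 b_1,b_2\rangle=\langle a_1\sqcup b_1,a_2\sqcap b_2\rangle$, $\langle a_1,a_2\rangle\otimes\langle b_1,b_2\rangle=\langle a_1\sqcap b_1,a_2\sqcap b_2\rangle$, $\langle a_1,a_2\rangle\oplus\langle b_1,b_2\rangle=\langle a_1\sqcup b_1,a_2\sqcup b_2\rangle$, $\langle a_1,a_2\rangle\supset\langle b_1,b_2\rangle=\langle a_1\backslash b_1,a_1\sqcap b_2\rangle$, $\neg\langle a_1,a_2\rangle=\langle a_2,a_1\rangle$. $\mathcal{FOUR}_\supset$ is the algebra on $\{\mathsf f,\bot,\top,\mathsf t\}$ in which $\mathsf f$ is least and $\mathsf t$ greatest for $\le_t$ with $\bot,\top$ incomparable, $\bot$ is least and $\top$ greatest for $\le_k$ with $\mathsf f,\mathsf t$ incomparable, $\neg$ exchanges $\mathsf f,\mathsf t$ and fixes $\bot,\top$, and $a\supset b=b$ if $a\in\{\mathsf t,\top\}$ and $a\supset b=\mathsf t$ otherwise. **Theorem.** (A) Let $A$ be an I-algebra. Then $\langle A/{\sim},\supset\rangle$ is a Tarski algebra, $\langle A/{\sim},\wedge,\vee,\supset\rangle$ is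 a classical implicative lattice, and $\mathbf B=\langle A/{\sim}\odot A/{\sim},\supset\rangle$ is an implicative bilattice. Moreover: (i) the map $h\colon A\to A/{\sim}\times A/{\sim}$, $h(a)=\langle[a],[\neg a]\rangle$, is an embedding of $A$ into $\mathbf B$, i.e. an injective homomorphism with respect to $\supset$ and $\neg$; (ii) $\mathbf B$ is generated by the set $h[A]$; (iii) if $f\colon A\to B'$ is a $\{\supset,\neg\}$-homomorphism from $A$ to an implicative bilattice $\mathbf B'$, then there is a unique homomorphism $f'\colon\mathbf B\to\mathbf B'$ (with respect to all the operations) such that $f'\circ h=f$; if $f$ is injective, so is $f'$. (B) $\mathcal{FOUR}_\supset$ is an implicative bilattice, and the variety of I-algebras is generated by the $\{\supset,\neg\}$-reduct $\mathbf A_4$ of $\mathcal{FOUR}_\supset$: for every algebra $A=\langle A,\supset,\neg\rangle$, the algebra $A$ is an I-algebra if and only if it is a homomorphic image of a subalgebra of a direct power of $\mathbf A_4$, and if and only if it satisfies every equation that holds in $\mathbf A_4$. -/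

import Mathlib

universe u v w

/-- The operations of an algebra `⟨A, ⊃, ¬⟩`. -/
class ImpNegAlgebra (A : Type*) where
  imp : A → A → A
  neg : A → A

infixr:60 " ⊃ₐ " => ImpNegAlgebra.imp

prefix:max "∼ₐ" => ImpNegAlgebra.neg

/-- The term `p(x,y,z) = (x ⊃ y) ⊃ ((y ⊃ x) ⊃ ((¬x ⊃ ¬y) ⊃ ((¬y ⊃ ¬x) ⊃ z)))`. -/
def pTerm {A : Type*} [ImpNegAlgebra A] (x y z : A) : A :=
  (x ⊃ₐ y) ⊃ₐ ((y ⊃ₐ x) ⊃ₐ ((∼ₐx ⊃ₐ ∼ₐy) ⊃ₐ ((∼ₐy ⊃ₐ ∼ₐx) ⊃ₐ z)))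

/-- I-algebras. -/
class IsIAlgebra (A : Type*) [ImpNegAlgebra A] : Prop where
  i1 : ∀ x y : A, (x ⊃ₐ x) ⊃ₐ y = y
  i2 : ∀ x y z : A, x ⊃ₐ (y ⊃ₐ z) = (x ⊃ₐ y) ⊃ₐ (x ⊃ₐ z)
  i2' : ∀ x y z : A, x ⊃ₐ (y ⊃ₐ z) = y ⊃ₐ (x ⊃ₐ z)
  i3 : ∀ x y : A, ((x ⊃ₐ y) ⊃ₐ x) ⊃ₐ x = x ⊃ₐ x
  i4 : ∀ x y z : A, x ⊃ₐ (∼ₐy ⊃ₐ z) = ∼ₐ(x ⊃ₐ y) ⊃ₐ z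
  i5 : ∀ x : A, ∼ₐ∼ₐx = x
  i6 : ∀ x y : A, pTerm x y x = pTerm x y y

/-- Homomorphisms of algebras `⟨A, ⊃, ¬⟩`. -/
structure IsImpNegHom {A B : Type*} [ImpNegAlgebra A] [ImpNegAlgebra B] (f : A → B) : Prop where
  map_imp : ∀ x y, f (x ⊃ₐ y) = f x ⊃ₐ f y
  map_neg : ∀ x, f (∼ₐx) = ∼ₐ(f x)

/-- `meet` and `join` are the operations of a lattice. -/
structure IsLatticePair {α : Type*} (meet join : α → α → α) : Prop where
  meet_comm : ∀ x y, meet x y = meet y x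
  join_comm : ∀ x y, join x y = join y x
  meet_assoc : ∀ x y z, meet (meet x y) z = meet x (meet y z)
  join_assoc : ∀ x y z, join (join x y) z = join x (join y z)
  meet_absorb : ∀ x y, meet x (join x y) = x
  join_absorb : ∀ x y, join x (meet x y) = x

/-- The operations of an algebra `⟨B, ∧, ∨, ⊗, ⊕, ⊃, ¬⟩`. -/
class BilatticeOps (B : Type*) extends ImpNegAlgebra B where
  /-- meet of the truth order -/
  tmeet : B → B → B
  /-- join of the truth order -/
  tjoin : B → B → B
  /-- meet of the knowledge order -/
  kmeet : B → B → B
  /-- join of the knowledge order -/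
  kjoin : B → B → B

infixl:70 " ∧ₜ " => BilatticeOps.tmeet

infixl:66 " ∨ₜ " => BilatticeOps.tjoin

infixl:70 " ⊗ₖ " => BilatticeOps.kmeet

infixl:66 " ⊕ₖ " => BilatticeOps.kjoin

/-- Implicative bilattices: a bilattice (two lattices and an involutive negation that reverses the
truth order and preserves the knowledge order) together with an implication satisfying
(IB1)-(IB6). -/
class IsImplicativeBilattice (B : Type*) [BilatticeOps B] : Prop where
  tlattice : IsLatticePair (BilatticeOps.tmeet (B := B)) (BilatticeOps.tjoin (B := B))
  klattice : IsLatticePair (BilatticeOps.kmeet (B := B)) (BilatticeOps.kjoin (B := B))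
  neg1 : ∀ a b : B, a ∧ₜ b = a → ∼ₐb ∧ₜ ∼ₐa = ∼ₐb
  neg2 : ∀ a b : B, a ⊗ₖ b = a → ∼ₐa ⊗ₖ ∼ₐb = ∼ₐa
  neg3 : ∀ a : B, a = ∼ₐ∼ₐa
  ib1 : ∀ x y : B, (x ⊃ₐ x) ⊃ₐ y = y
  ib2 : ∀ x y z : B, x ⊃ₐ (y ⊃ₐ z) = (x ∧ₜ y) ⊃ₐ z
  ib2' : ∀ x y z : B, (x ∧ₜ y) ⊃ₐ z = (x ⊗ₖ y) ⊃ₐ z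
  ib3 : ∀ x y : B, ((x ⊃ₐ y) ⊃ₐ x) ⊃ₐ x = x ⊃ₐ x
  ib4 : ∀ x y z : B, (x ∨ₜ y) ⊃ₐ z = (x ⊃ₐ z) ∧ₜ (y ⊃ₐ z)
  ib4' : ∀ x y z : B, (x ⊃ₐ z) ∧ₜ (y ⊃ₐ z) = (x ⊕ₖ y) ⊃ₐ z
  ib5 : ∀ x y : B, x ∧ₜ ((x ⊃ₐ y) ⊃ₐ (x ⊗ₖ y)) = x
  ib6 : ∀ x y z : B, ∼ₐ(x ⊃ₐ y) ⊃ₐ z = (x ∧ₜ ∼ₐy) ⊃ₐ z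

/-- Homomorphisms of algebras `⟨B, ∧, ∨, ⊗, ⊕, ⊃, ¬⟩`. -/
structure IsBilatticeHom {B C : Type*} [BilatticeOps B] [BilatticeOps C] (f : B → C) : Prop
    extends IsImpNegHom f where
  map_tmeet : ∀ x y, f (x ∧ₜ y) = f x ∧ₜ f y
  map_tjoin : ∀ x y, f (x ∨ₜ y) = f x ∨ₜ f y
  map_kmeet : ∀ x y, f (x ⊗ₖ y) = f x ⊗ₖ f y
  map_kjoin : ∀ x y, f (x ⊕ₖ y) = f x ⊕ₖ f y

/-- Subsets closed under all the operations `∧, ∨, ⊗, ⊕, ⊃, ¬`. -/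
structure IsBilatticeSubuniverse {B : Type*} [BilatticeOps B] (S : Set B) : Prop where
  neg_mem : ∀ x ∈ S, ∼ₐx ∈ S
  imp_mem : ∀ x ∈ S, ∀ y ∈ S, x ⊃ₐ y ∈ S
  tmeet_mem : ∀ x ∈ S, ∀ y ∈ S, x ∧ₜ y ∈ S
  tjoin_mem : ∀ x ∈ S, ∀ y ∈ S, x ∨ₜ y ∈ S
  kmeet_mem : ∀ x ∈ S, ∀ y ∈ S, x ⊗ₖ y ∈ S
  kjoin_mem : ∀ x ∈ S, ∀ y ∈ S, x ⊕ₖ y ∈ S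

/-- The algebra `B` is generated by `X`: the only subuniverse that contains `X` is `B`. -/
def IsGeneratedBy (B : Type*) [BilatticeOps B] (X : Set B) : Prop :=
  ∀ S : Set B, IsBilatticeSubuniverse S → X ⊆ S → S = Set.univ

/-- The operations of an algebra `⟨L, ⊓, ⊔, \⟩`. -/
class LatticeImpOps (L : Type*) where
  meet : L → L → L
  join : L → L → L
  rimp : L → L → L

/-- Tarski algebras `⟨L, ⊃⟩`. -/
structure IsTarski {L : Type*} (imp : L → L → L) : Prop where
  t1 : ∀ x y, imp (imp x y) x = x
  t2 : ∀ x y z, imp x (imp y z) = imp y (imp x z)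
  t3 : ∀ x y, imp (imp x y) y = imp (imp y x) x

open LatticeImpOps in
/-- Classical implicative lattices `⟨L, ⊓, ⊔, \⟩`: relatively complemented distributive lattices
with a maximum `1`, where `a \ b` is the relative complement of `a` in the interval
`[a ⊓ b, 1]`. Here `x ≤ y` is written `meet x y = x`. -/
class IsClassicalImplicativeLattice (L : Type*) [LatticeImpOps L] : Prop where
  lattice : IsLatticePair (meet (L := L)) (join (L := L))
  distrib : ∀ x y z : L, meet x (join y z) = join (meet x y) (meet x z)
  relCompl : ∀ a x b : L, meet a x = a → meet x b = x →
    ∃ c : L, meet x c = a ∧ join x c = b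
  meet_rimp : ∀ a b : L, meet a (rimp a b) = meet a b
  top : ∃ one : L, (∀ x : L, meet x one = x) ∧ ∀ a b : L, join a (rimp a b) = one

/-- The universe `L × L` of the product bilattice `L ⊙ L`. -/
@[ext]
structure ProductBilattice (L : Type*) where
  fst : L
  snd : L

open LatticeImpOps in
/-- The operations of `⟨L ⊙ L, ⊃⟩`. -/
instance {L : Type*} [LatticeImpOps L] : BilatticeOps (ProductBilattice L) where
  tmeet a b := ⟨meet a.fst b.fst, join a.snd b.snd⟩
  tjoin a b := ⟨join a.fst b.fst, meet a.snd b.snd⟩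
  kmeet a b := ⟨meet a.fst b.fst, meet a.snd b.snd⟩
  kjoin a b := ⟨join a.fst b.fst, join a.snd b.snd⟩
  imp a b := ⟨rimp a.fst b.fst, meet a.fst b.snd⟩
  neg a := ⟨a.snd, a.fst⟩

section Quotient

variable {A : Type*} [ImpNegAlgebra A]

/-- `E(a)` abbreviates `a = a ⊃ a`. -/
def EPred (a : A) : Prop := a = a ⊃ₐ a

/-- `a ∼ b` iff `E(a ⊃ b)` and `E(b ⊃ a)`. -/
def SimRel (a b : A) : Prop := EPred (a ⊃ₐ b) ∧ EPred (b ⊃ₐ a)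

variable [IsIAlgebra A]

theorem simRel_iff (a b : A) : SimRel a b ↔ ∀ c, a ⊃ₐ c = b ⊃ₐ c := by
  constructor
  · rintro ⟨h1, h2⟩ c
    have e1 : (a ⊃ₐ b) ⊃ₐ (a ⊃ₐ c) = a ⊃ₐ c := by
      rw [EPred] at h1; rw [h1]; exact IsIAlgebra.i1 _ _
    have e2 : (b ⊃ₐ a) ⊃ₐ (b ⊃ₐ c) = b ⊃ₐ c := by
      rw [EPred] at h2; rw [h2]; exact IsIAlgebra.i1 _ _
    rw [← e1, ← e2, ← IsIAlgebra.i2, ← IsIAlgebra.i2, IsIAlgebra.i2']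
  · intro h
    refine ⟨?_, ?_⟩
    · rw [EPred, h b, IsIAlgebra.i1]
    · rw [EPred, ← h a, IsIAlgebra.i1]

/-- The relation `∼` as an equivalence relation. -/
def simSetoid (A : Type*) [ImpNegAlgebra A] [IsIAlgebra A] : Setoid A where
  r := SimRel
  iseqv :=
    { refl := fun a => (simRel_iff a a).2 fun _ => rfl
      symm := fun h => ⟨h.2, h.1⟩
      trans := fun h h' => (simRel_iff _ _).2 fun c =>
        ((simRel_iff _ _).1 h c).trans ((simRel_iff _ _).1 h' c) }

theorem simRel_imp {a b c d : A} (h : SimRel a b) (h' : SimRel c d) :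
    SimRel (a ⊃ₐ c) (b ⊃ₐ d) := by
  have key : ∀ x y z : A, EPred (y ⊃ₐ z) → EPred ((x ⊃ₐ y) ⊃ₐ (x ⊃ₐ z)) := by
    intro x y z hyz
    rw [EPred] at hyz
    rw [EPred, ← IsIAlgebra.i2, ← IsIAlgebra.i2, ← hyz]
  rw [← (simRel_iff a b).1 h d]
  exact ⟨key a c d h'.1, key a d c h'.2⟩

theorem simRel_meet {a b c d : A} (h : SimRel a b) (h' : SimRel c d) :
    SimRel (∼ₐ(a ⊃ₐ ∼ₐc)) (∼ₐ(b ⊃ₐ ∼ₐd)) := by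
  rw [simRel_iff] at *
  intro e
  rw [← IsIAlgebra.i4, ← IsIAlgebra.i4, IsIAlgebra.i5, IsIAlgebra.i5, h, h']

/-- The quotient `A/∼`. -/
def SimQuotient (A : Type*) [ImpNegAlgebra A] [IsIAlgebra A] : Type _ := Quotient (simSetoid A)

/-- The class `[a]` of `a` in `A/∼`. -/
def simClass (a : A) : SimQuotient A := Quotient.mk (simSetoid A) a

/-- `[a] ⊃ [b] = [a ⊃ b]`. -/
def simImp : SimQuotient A → SimQuotient A → SimQuotient A :=
  Quotient.map₂ (fun a b => a ⊃ₐ b) fun _ _ h _ _ h' => simRel_imp h h'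

/-- `[a] ∧ [b] = [¬(a ⊃ ¬b)]`. -/
def simMeet : SimQuotient A → SimQuotient A → SimQuotient A :=
  Quotient.map₂ (fun a b => ∼ₐ(a ⊃ₐ ∼ₐb)) fun _ _ h _ _ h' => simRel_meet h h'

/-- The operations of `⟨A/∼, ∧, ∨, ⊃⟩`, where `[a] ∨ [b] = ([a] ⊃ [b]) ⊃ [b]`. -/
instance : LatticeImpOps (SimQuotient A) where
  meet := simMeet
  join x y := simImp (simImp x y) y
  rimp := simImp

/-- The map `h : A → A/∼ × A/∼`, `h(a) = ⟨[a], [¬a]⟩`. -/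
def simEmbed (a : A) : ProductBilattice (SimQuotient A) := ⟨simClass a, simClass (∼ₐa)⟩

end Quotient

/-- The four truth values. -/
inductive Four where
  | f
  | bot
  | top
  | t

/-- The algebra `FOUR⊃`. In the truth order `f` is the minimum, `t` the maximum, and `bot`, `top`
are incomparable; in the knowledge order `bot` is the minimum, `top` the maximum, and `f`, `t` are
incomparable. Negation exchanges `f` and `t`; `a ⊃ b` is `b` if `a ∈ {t, top}` and `t` otherwise. -/
instance : BilatticeOps Four where
  tmeet
    | .f, _ => .f
    | _, .f => .f
    | .t, y => y
    | x, .t => x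
    | .bot, .bot => .bot
    | .top, .top => .top
    | .bot, .top => .f
    | .top, .bot => .f
  tjoin
    | .t, _ => .t
    | _, .t => .t
    | .f, y => y
    | x, .f => x
    | .bot, .bot => .bot
    | .top, .top => .top
    | .bot, .top => .t
    | .top, .bot => .t
  kmeet
    | .bot, _ => .bot
    | _, .bot => .bot
    | .top, y => y
    | x, .top => x
    | .f, .f => .f
    | .t, .t => .t
    | .f, .t => .bot
    | .t, .f => .bot
  kjoin
    | .top, _ => .top
    | _, .top => .top
    | .bot, y => y
    | x, .bot => x
    | .f, .f => .f
    | .t, .t => .t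
    | .f, .t => .top
    | .t, .f => .top
  imp
    | .t, y => y
    | .top, y => y
    | _, _ => .t
  neg
    | .f => .t
    | .t => .f
    | .top => .top
    | .bot => .bot

/-- The operations of a direct power of `⟨C, ⊃, ¬⟩`. -/
instance {I C : Type*} [ImpNegAlgebra C] : ImpNegAlgebra (I → C) where
  imp x y := fun i => x i ⊃ₐ y i
  neg x := fun i => ∼ₐ(x i)

/-- `A` belongs to `HSP(C)`: it is a homomorphic image of (an algebra `D` isomorphic to)
a subalgebra of a direct power of `C`. -/
def InHSP (C : Type w) [ImpNegAlgebra C] (A : Type u) [ImpNegAlgebra A] : Prop :=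
  ∃ (I D : Type u) (_ : ImpNegAlgebra D) (g : D → I → C) (q : D → A),
    IsImpNegHom g ∧ Function.Injective g ∧ IsImpNegHom q ∧ Function.Surjective q

/-- Terms in the language `{⊃, ¬}` over countably many variables. -/
inductive ImpNegTerm where
  | var : ℕ → ImpNegTerm
  | imp : ImpNegTerm → ImpNegTerm → ImpNegTerm
  | neg : ImpNegTerm → ImpNegTerm

/-- The value of a term under an assignment of the variables. -/
def ImpNegTerm.eval {A : Type*} [ImpNegAlgebra A] (e : ℕ → A) : ImpNegTerm → A
  | .var n => e n
  | .imp s t => s.eval e ⊃ₐ t.eval e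
  | .neg s => ∼ₐ(s.eval e)

/-- The equation `s ≈ t` holds in `A`. -/
def SatisfiesEq (A : Type*) [ImpNegAlgebra A] (s t : ImpNegTerm) : Prop :=
  ∀ e : ℕ → A, s.eval e = t.eval e

/-! An element `x` of `Four` is the same thing as a pair of classical truth values: whether `x` is
designated and whether `∼ₐx` is. In these coordinates every operation is Boolean, so identities of
`Four` are propositional tautologies.

The bridge to arbitrary algebras is a prime filter theorem that needs only (I1)-(I5). If `E(a ⊃ b)`
fails, a filter `F` containing `a` and maximal among those omitting `b` commutes with `⊃`
classically, by Peirce's law (I3), and `x ↦ (x ∈ F, ∼ₐx ∈ F)` is a homomorphism to `Four`. Hence `a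
∼ b` holds exactly when all homomorphisms to `Four` agree on whether `a` and `b` are designated, and
with (I6) these homomorphisms separate points. This gives (B), and it reduces identities in the
quotient and in its product to tautologies.

For (iii), an implicative bilattice also satisfies (I1)-(I5). Its `{⊃, ¬}`-homomorphisms to `Four`
preserve all the operations and separate points, so equations in the target can be checked in `Four`
as well. The term `pairTerm` rebuilds `⟨[a], [b]⟩` from `h(a)` and `h(b)`; it yields generation,
uniqueness and the formula for the extension. -/

/-! ### The four truth values as pairs of propositions -/

namespace Four

/-- The designated truth values are `t` and `top`. -/
def Desig : Four → Prop
  | .t => True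
  | .top => True
  | _ => False

theorem eq_iff (x y : Four) : x = y ↔ (Desig x ↔ Desig y) ∧ (Desig (∼ₐx) ↔ Desig (∼ₐy)) := by
  cases x <;> cases y <;> simp [Desig, ImpNegAlgebra.neg]

theorem exists_of_props (p q : Prop) : ∃ x : Four, (Desig x ↔ p) ∧ (Desig (∼ₐx) ↔ q) := by
  by_cases hp : p <;> by_cases hq : q
  · exact ⟨.top, by simp [Desig, ImpNegAlgebra.neg, hp, hq]⟩
  · exact ⟨.t, by simp [Desig, ImpNegAlgebra.neg, hp, hq]⟩
  · exact ⟨.f, by simp [Desig, ImpNegAlgebra.neg, hp, hq]⟩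
  · exact ⟨.bot, by simp [Desig, ImpNegAlgebra.neg, hp, hq]⟩

@[simp] theorem neg_neg (x : Four) : ∼ₐ∼ₐx = x := by
  cases x <;> rfl

@[simp] theorem desig_imp (x y : Four) : Desig (x ⊃ₐ y) ↔ (Desig x → Desig y) := by
  cases x <;> cases y <;> simp [Desig, ImpNegAlgebra.imp]

@[simp] theorem desig_neg_imp (x y : Four) : Desig (∼ₐ(x ⊃ₐ y)) ↔ Desig x ∧ Desig (∼ₐy) := by
  cases x <;> cases y <;> simp [Desig, ImpNegAlgebra.imp, ImpNegAlgebra.neg]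

@[simp] theorem desig_tmeet (x y : Four) : Desig (x ∧ₜ y) ↔ Desig x ∧ Desig y := by
  cases x <;> cases y <;> simp [Desig, BilatticeOps.tmeet]

@[simp] theorem desig_neg_tmeet (x y : Four) :
    Desig (∼ₐ(x ∧ₜ y)) ↔ Desig (∼ₐx) ∨ Desig (∼ₐy) := by
  cases x <;> cases y <;> simp [Desig, BilatticeOps.tmeet, ImpNegAlgebra.neg]

@[simp] theorem desig_tjoin (x y : Four) : Desig (x ∨ₜ y) ↔ Desig x ∨ Desig y := by
  cases x <;> cases y <;> simp [Desig, BilatticeOps.tjoin]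

@[simp] theorem desig_neg_tjoin (x y : Four) :
    Desig (∼ₐ(x ∨ₜ y)) ↔ Desig (∼ₐx) ∧ Desig (∼ₐy) := by
  cases x <;> cases y <;> simp [Desig, BilatticeOps.tjoin, ImpNegAlgebra.neg]

@[simp] theorem desig_kmeet (x y : Four) : Desig (x ⊗ₖ y) ↔ Desig x ∧ Desig y := by
  cases x <;> cases y <;> simp [Desig, BilatticeOps.kmeet]

@[simp] theorem desig_neg_kmeet (x y : Four) :
    Desig (∼ₐ(x ⊗ₖ y)) ↔ Desig (∼ₐx) ∧ Desig (∼ₐy) := by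
  cases x <;> cases y <;> simp [Desig, BilatticeOps.kmeet, ImpNegAlgebra.neg]

@[simp] theorem desig_kjoin (x y : Four) : Desig (x ⊕ₖ y) ↔ Desig x ∨ Desig y := by
  cases x <;> cases y <;> simp [Desig, BilatticeOps.kjoin]

@[simp] theorem desig_neg_kjoin (x y : Four) :
    Desig (∼ₐ(x ⊕ₖ y)) ↔ Desig (∼ₐx) ∨ Desig (∼ₐy) := by
  cases x <;> cases y <;> simp [Desig, BilatticeOps.kjoin, ImpNegAlgebra.neg]

theorem isImplicativeBilattice : IsImplicativeBilattice Four where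
  tlattice := by constructor <;> intros <;> simp only [eq_iff] <;> simp <;> tauto
  klattice := by constructor <;> intros <;> simp only [eq_iff] <;> simp <;> tauto
  neg1 a b h := by simp only [eq_iff] at *; simp at *; tauto
  neg2 a b h := by simp only [eq_iff] at *; simp at *; tauto
  neg3 a := by simp
  ib1 x y := by simp only [eq_iff]; simp
  ib2 x y z := by simp only [eq_iff]; simp; tauto
  ib2' x y z := by simp only [eq_iff]; simp
  ib3 x y := by simp only [eq_iff]; simp; tauto
  ib4 x y z := by simp only [eq_iff]; simp; tauto
  ib4' x y z := by simp only [eq_iff]; simp; tauto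
  ib5 x y := by simp only [eq_iff]; simp; tauto
  ib6 x y z := by simp only [eq_iff]; simp

theorem isIAlgebra : IsIAlgebra Four where
  i1 x y := by simp only [eq_iff]; simp
  i2 x y z := by simp only [eq_iff]; simp; tauto
  i2' x y z := by simp only [eq_iff]; simp; tauto
  i3 x y := by simp only [eq_iff]; simp; tauto
  i4 x y z := by simp only [eq_iff]; simp; tauto
  i5 x := by simp
  i6 x y := by simp only [pTerm, eq_iff]; simp; tauto

end Four

/-! ### Homomorphisms into `FOUR⊃` from implicative filters -/

/-- Algebras `⟨A, ⊃, ¬⟩` that satisfy (I1)-(I5). -/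
class IsWeakIAlgebra (A : Type*) [ImpNegAlgebra A] : Prop where
  i1 : ∀ x y : A, (x ⊃ₐ x) ⊃ₐ y = y
  i2 : ∀ x y z : A, x ⊃ₐ (y ⊃ₐ z) = (x ⊃ₐ y) ⊃ₐ (x ⊃ₐ z)
  i2' : ∀ x y z : A, x ⊃ₐ (y ⊃ₐ z) = y ⊃ₐ (x ⊃ₐ z)
  i3 : ∀ x y : A, ((x ⊃ₐ y) ⊃ₐ x) ⊃ₐ x = x ⊃ₐ x
  i4 : ∀ x y z : A, x ⊃ₐ (∼ₐy ⊃ₐ z) = ∼ₐ(x ⊃ₐ y) ⊃ₐ z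
  i5 : ∀ x : A, ∼ₐ∼ₐx = x

instance {A : Type*} [ImpNegAlgebra A] [IsIAlgebra A] : IsWeakIAlgebra A :=
  ⟨IsIAlgebra.i1, IsIAlgebra.i2, IsIAlgebra.i2', IsIAlgebra.i3, IsIAlgebra.i4, IsIAlgebra.i5⟩

theorem IsImpNegHom.desig_of_ePred {A : Type*} [ImpNegAlgebra A] {g : A → Four}
    (hg : IsImpNegHom g) {a : A} (h : EPred a) : (g a).Desig := by
  rw [EPred] at h
  rw [h, hg.map_imp]
  simp

theorem IsImpNegHom.comp {A B C : Type*} [ImpNegAlgebra A] [ImpNegAlgebra B] [ImpNegAlgebra C]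
    {g : B → C} {f : A → B} (hg : IsImpNegHom g) (hf : IsImpNegHom f) : IsImpNegHom (g ∘ f) where
  map_imp x y := by simp [hf.map_imp, hg.map_imp]
  map_neg x := by simp [hf.map_neg, hg.map_neg]

namespace IsWeakIAlgebra

variable {A : Type*} [ImpNegAlgebra A] [IsWeakIAlgebra A]

theorem ePred_self_imp (x : A) : EPred (x ⊃ₐ x) := (i1 _ _).symm

theorem ePred_imp_self_imp (x y : A) : EPred (x ⊃ₐ (y ⊃ₐ y)) := by
  rw [i2]; exact ePred_self_imp _

theorem ePred_weaken (x y : A) : EPred (x ⊃ₐ (y ⊃ₐ x)) := by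
  rw [i2']; exact ePred_imp_self_imp _ _

theorem EPred.imp_eq {e : A} (h : EPred e) (y : A) : e ⊃ₐ y = y := by
  rw [EPred] at h; rw [h, i1]

/-- Sets that contain every `x` with `E(x)` and are closed under detachment. -/
structure IsFilter (F : Set A) : Prop where
  ePred_mem : ∀ x, EPred x → x ∈ F
  mp : ∀ x y, x ⊃ₐ y ∈ F → x ∈ F → y ∈ F

omit [IsWeakIAlgebra A] in
theorem IsFilter.sUnion {c : Set (Set A)} (hc : IsChain (· ⊆ ·) c) (hne : c.Nonempty)
    (h : ∀ F ∈ c, IsFilter F) : IsFilter (⋃₀ c) where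
  ePred_mem x hx := by
    obtain ⟨F, hF⟩ := hne
    exact ⟨F, hF, (h F hF).ePred_mem x hx⟩
  mp := by
    rintro x y ⟨F, hF, hxF⟩ ⟨G, hG, hxG⟩
    rcases hc.total hF hG with hFG | hGF
    · exact ⟨G, hG, (h G hG).mp x y (hFG hxF) hxG⟩
    · exact ⟨F, hF, (h F hF).mp x y hxF (hGF hxG)⟩

theorem IsFilter.weaken {F : Set A} (hF : IsFilter F) (u : A) {x : A} (hx : x ∈ F) :
    u ⊃ₐ x ∈ F :=
  hF.mp _ _ (hF.ePred_mem _ (ePred_weaken x u)) hx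

/-- Deduction theorem: this set is the filter generated by `F` and `u`. Closure under detachment is
(I2). -/
theorem IsFilter.extend {F : Set A} (hF : IsFilter F) (u : A) : IsFilter {x | u ⊃ₐ x ∈ F} where
  ePred_mem x hx := hF.weaken u (hF.ePred_mem x hx)
  mp x y hxy hx := by
    simp only [Set.mem_ofPred_eq] at *
    rw [i2] at hxy
    exact hF.mp _ _ hxy hx

theorem isFilter_ePred : IsFilter {x : A | EPred x} where
  ePred_mem _ hx := hx
  mp x y hxy hx := by
    simp only [Set.mem_ofPred_eq] at *
    rwa [EPred.imp_eq hx] at hxy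

theorem exists_prime_filter {a b : A} (h : ¬ EPred (a ⊃ₐ b)) :
    ∃ F : Set A, IsFilter F ∧ a ∈ F ∧ b ∉ F ∧ ∀ x y, x ⊃ₐ y ∈ F ↔ (x ∈ F → y ∈ F) := by
  obtain ⟨F, haF, hmax⟩ := zorn_subset_nonempty {F : Set A | IsFilter F ∧ b ∉ F}
    (fun c hc hchain hne => ⟨⋃₀ c, ⟨IsFilter.sUnion hchain hne fun F hF => (hc hF).1,
      fun ⟨F, hF, hb⟩ => (hc hF).2 hb⟩, fun F hF => Set.subset_sUnion_of_mem hF⟩)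
    {x | EPred (a ⊃ₐ x)} ⟨isFilter_ePred.extend a, h⟩
  obtain ⟨hF, hb⟩ := hmax.prop
  -- Otherwise the filter generated by `F` and `u` still omits `b`, so by maximality it lies in `F`,
  -- although it contains `u`.
  have key : ∀ u, u ∉ F → u ⊃ₐ b ∈ F := by
    intro u hu
    by_contra hub
    refine hu (hmax.le_of_ge (y := {x | u ⊃ₐ x ∈ F}) ⟨hF.extend u, hub⟩
      (fun x hx => hF.weaken u hx) ?_)
    exact hF.ePred_mem _ (ePred_self_imp u)
  refine ⟨F, hF, haF (ePred_self_imp a), hb, fun x y => ⟨hF.mp x y, fun hxy => ?_⟩⟩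
  by_cases hy : y ∈ F
  · exact hF.weaken x hy
  by_contra hn
  have h1 := key x fun hx => hy (hxy hx)
  have h2 := key _ hn
  -- Assuming `b ⊃ y`, the element `x ⊃ b` yields `x ⊃ y`, and then `(x ⊃ y) ⊃ b` yields `b`.
  -- Peirce's law turns the resulting membership into `b ∈ F`.
  have h3 : (b ⊃ₐ y) ⊃ₐ b ∈ F := by
    have hG := hF.extend (b ⊃ₐ y)
    refine hG.mp (x ⊃ₐ y) b (hF.weaken _ h2) (hG.mp (x ⊃ₐ b) _ ?_ (hF.weaken _ h1))
    simp only [Set.mem_ofPred_eq]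
    rw [← i2]
    exact hF.ePred_mem _ (ePred_weaken _ _)
  exact hb (hF.mp _ _ (by rw [i3]; exact hF.ePred_mem _ (ePred_self_imp b)) h3)

theorem exists_hom_of_not_ePred_imp {a b : A} (h : ¬ EPred (a ⊃ₐ b)) :
    ∃ g : A → Four, IsImpNegHom g ∧ (g a).Desig ∧ ¬ (g b).Desig := by
  obtain ⟨F, hF, ha, hb, himp⟩ := exists_prime_filter h
  choose g hg hg' using fun x : A => Four.exists_of_props (x ∈ F) (∼ₐx ∈ F)
  -- (I4) makes `∼ₐ(x ⊃ y)` act as the conjunction of `x` and `∼ₐy`, matching `Four.desig_neg_imp`.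
  have hneg : ∀ x y, ∼ₐ(x ⊃ₐ y) ∈ F ↔ x ∈ F ∧ ∼ₐy ∈ F := by
    intro x y
    constructor
    · intro hxy
      refine ⟨hF.mp _ _ ?_ hxy, hF.mp _ _ ?_ hxy⟩
      · rw [← i4]; exact hF.ePred_mem _ (ePred_weaken _ _)
      · rw [← i4]; exact hF.ePred_mem _ (ePred_imp_self_imp _ _)
    · rintro ⟨hx, hy⟩
      refine hF.mp _ _ (hF.mp _ _ ?_ hx) hy
      rw [i4]
      exact hF.ePred_mem _ (ePred_self_imp _)
  refine ⟨g, ⟨fun x y => ?_, fun x => ?_⟩, (hg a).2 ha, fun hgb => hb ((hg b).1 hgb)⟩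
  · rw [Four.eq_iff]
    simp [hg, hg', himp, hneg]
  · rw [Four.eq_iff]
    simp [hg, hg', i5]

theorem ePred_iff_forall_hom (a : A) :
    EPred a ↔ ∀ g : A → Four, IsImpNegHom g → (g a).Desig := by
  refine ⟨fun h g hg => hg.desig_of_ePred h, fun h => ?_⟩
  by_contra ha
  -- Writing `a` as `(a ⊃ a) ⊃ a` brings it to the form required by the separation lemma.
  rw [← i1 a a] at ha
  obtain ⟨g, hg, -, hga⟩ := exists_hom_of_not_ePred_imp ha
  exact hga (h g hg)

theorem simRel_iff_forall_hom (a b : A) :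
    SimRel a b ↔ ∀ g : A → Four, IsImpNegHom g → ((g a).Desig ↔ (g b).Desig) := by
  simp only [SimRel, ePred_iff_forall_hom]
  constructor
  · rintro ⟨h1, h2⟩ g hg
    have h1 := h1 g hg
    have h2 := h2 g hg
    rw [hg.map_imp, Four.desig_imp] at h1 h2
    exact ⟨h1, h2⟩
  · intro h
    refine ⟨fun g hg => ?_, fun g hg => ?_⟩ <;> rw [hg.map_imp, Four.desig_imp]
    exacts [(h g hg).1, (h g hg).2]

end IsWeakIAlgebra

open IsWeakIAlgebra

/-- The hypotheses say that `E` holds for the four antecedents of `pTerm a b`, so (I1) deletes them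
and (I6) becomes `a = b`. -/
theorem IsIAlgebra.eq_of_simRel {A : Type*} [ImpNegAlgebra A] [IsIAlgebra A] {a b : A}
    (h : SimRel a b) (h' : SimRel (∼ₐa) (∼ₐb)) : a = b := by
  have h6 := IsIAlgebra.i6 a b
  simpa only [pTerm, EPred.imp_eq h.1, EPred.imp_eq h.2, EPred.imp_eq h'.1,
    EPred.imp_eq h'.2] using h6

/-- The homomorphisms from an I-algebra to `FOUR⊃` separate its elements. -/
theorem IsIAlgebra.eq_of_forall_hom {A : Type*} [ImpNegAlgebra A] [IsIAlgebra A] {a b : A}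
    (h : ∀ g : A → Four, IsImpNegHom g → g a = g b) : a = b := by
  refine eq_of_simRel ((simRel_iff_forall_hom _ _).2 fun g hg => ?_)
    ((simRel_iff_forall_hom _ _).2 fun g hg => ?_)
  · rw [h g hg]
  · rw [hg.map_neg, hg.map_neg, h g hg]

/-! ### The quotient of an I-algebra -/

namespace SimQuotient

variable {A : Type*} [ImpNegAlgebra A] [IsIAlgebra A]

/-- The truth valuation of `A/∼` induced by a homomorphism from `A` to `FOUR⊃`. -/
def valuation {g : A → Four} (hg : IsImpNegHom g) : SimQuotient A → Prop :=
  Quotient.lift (fun a => (g a).Desig) fun a b h =>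
    propext ((simRel_iff_forall_hom a b).1 h g hg)

theorem exists_rep (x : SimQuotient A) : ∃ a, simClass a = x := Quotient.exists_rep x

theorem ext_valuation {x y : SimQuotient A}
    (h : ∀ (g : A → Four) (hg : IsImpNegHom g), valuation hg x ↔ valuation hg y) : x = y := by
  obtain ⟨a, rfl⟩ := exists_rep x
  obtain ⟨b, rfl⟩ := exists_rep y
  exact Quotient.sound ((simRel_iff_forall_hom a b).2 h)

variable {g : A → Four} (hg : IsImpNegHom g)

@[simp] theorem valuation_simClass (a : A) : valuation hg (simClass a) ↔ (g a).Desig := Iff.rfl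

@[simp] theorem valuation_imp (x y : SimQuotient A) :
    valuation hg (simImp x y) ↔ (valuation hg x → valuation hg y) := by
  obtain ⟨a, rfl⟩ := exists_rep x
  obtain ⟨b, rfl⟩ := exists_rep y
  change (g (a ⊃ₐ b)).Desig ↔ ((g a).Desig → (g b).Desig)
  rw [hg.map_imp, Four.desig_imp]

@[simp] theorem valuation_rimp (x y : SimQuotient A) :
    valuation hg (LatticeImpOps.rimp x y) ↔ (valuation hg x → valuation hg y) :=
  valuation_imp hg x y

@[simp] theorem valuation_meet (x y : SimQuotient A) :
    valuation hg (LatticeImpOps.meet x y) ↔ valuation hg x ∧ valuation hg y := by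
  obtain ⟨a, rfl⟩ := exists_rep x
  obtain ⟨b, rfl⟩ := exists_rep y
  change (g (∼ₐ(a ⊃ₐ ∼ₐb))).Desig ↔ (g a).Desig ∧ (g b).Desig
  simp [hg.map_imp, hg.map_neg]

@[simp] theorem valuation_join (x y : SimQuotient A) :
    valuation hg (LatticeImpOps.join x y) ↔ valuation hg x ∨ valuation hg y := by
  change valuation hg (simImp (simImp x y) y) ↔ _
  simp only [valuation_imp]
  tauto

theorem valuation_congr {x y : SimQuotient A} (h : x = y) : valuation hg x ↔ valuation hg y := by
  rw [h]

theorem isTarski : IsTarski (simImp (A := A)) where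
  t1 x y := ext_valuation fun g hg => by simp; tauto
  t2 x y z := ext_valuation fun g hg => by simp; tauto
  t3 x y := ext_valuation fun g hg => by simp; tauto

theorem isClassicalImplicativeLattice [Nonempty A] :
    IsClassicalImplicativeLattice (SimQuotient A) where
  lattice := by constructor <;> intros <;> refine ext_valuation fun g hg => ?_ <;> simp <;> tauto
  distrib x y z := ext_valuation fun g hg => by simp; tauto
  relCompl a x b hax hxb := by
    -- The Boolean relative complement of `x` in `[a, b]`: the part of `b` on which `x` implies `a`.
    refine ⟨LatticeImpOps.meet b (LatticeImpOps.rimp x a), ext_valuation fun g hg => ?_,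
      ext_valuation fun g hg => ?_⟩ <;>
    · have h1 := valuation_congr hg hax
      have h2 := valuation_congr hg hxb
      simp at *
      tauto
  meet_rimp a b := ext_valuation fun g hg => by simp; tauto
  top := by
    obtain ⟨a⟩ := ‹Nonempty A›
    refine ⟨simClass (a ⊃ₐ a), fun x => ext_valuation fun g hg => ?_,
      fun x y => ext_valuation fun g hg => ?_⟩ <;> simp [hg.map_imp]
    tauto

end SimQuotient

/-! ### The product bilattice over the quotient -/

namespace ProductBilattice

section Projections

variable {L : Type*} [LatticeImpOps L] (x y : ProductBilattice L)

@[simp] theorem fst_tmeet : (x ∧ₜ y).fst = LatticeImpOps.meet x.fst y.fst := rfl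
@[simp] theorem snd_tmeet : (x ∧ₜ y).snd = LatticeImpOps.join x.snd y.snd := rfl
@[simp] theorem fst_tjoin : (x ∨ₜ y).fst = LatticeImpOps.join x.fst y.fst := rfl
@[simp] theorem snd_tjoin : (x ∨ₜ y).snd = LatticeImpOps.meet x.snd y.snd := rfl
@[simp] theorem fst_kmeet : (x ⊗ₖ y).fst = LatticeImpOps.meet x.fst y.fst := rfl
@[simp] theorem snd_kmeet : (x ⊗ₖ y).snd = LatticeImpOps.meet x.snd y.snd := rfl
@[simp] theorem fst_kjoin : (x ⊕ₖ y).fst = LatticeImpOps.join x.fst y.fst := rfl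
@[simp] theorem snd_kjoin : (x ⊕ₖ y).snd = LatticeImpOps.join x.snd y.snd := rfl
@[simp] theorem fst_imp : (x ⊃ₐ y).fst = LatticeImpOps.rimp x.fst y.fst := rfl
@[simp] theorem snd_imp : (x ⊃ₐ y).snd = LatticeImpOps.meet x.fst y.snd := rfl
@[simp] theorem fst_neg : (∼ₐx).fst = x.snd := rfl
@[simp] theorem snd_neg : (∼ₐx).snd = x.fst := rfl

end Projections

open SimQuotient

variable {A : Type*} [ImpNegAlgebra A] [IsIAlgebra A]

theorem ext_valuation {x y : ProductBilattice (SimQuotient A)}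
    (h : ∀ (g : A → Four) (hg : IsImpNegHom g), (valuation hg x.fst ↔ valuation hg y.fst) ∧
      (valuation hg x.snd ↔ valuation hg y.snd)) : x = y :=
  ProductBilattice.ext (SimQuotient.ext_valuation fun g hg => (h g hg).1)
    (SimQuotient.ext_valuation fun g hg => (h g hg).2)

theorem isImplicativeBilattice : IsImplicativeBilattice (ProductBilattice (SimQuotient A)) where
  tlattice := by constructor <;> intros <;> refine ext_valuation fun g hg => ?_ <;> simp <;> tauto
  klattice := by constructor <;> intros <;> refine ext_valuation fun g hg => ?_ <;> simp <;> tauto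
  neg1 a b h := ext_valuation fun g hg => by
    have h1 := valuation_congr hg (congrArg fst h)
    have h2 := valuation_congr hg (congrArg snd h)
    simp at *
    tauto
  neg2 a b h := ext_valuation fun g hg => by
    have h1 := valuation_congr hg (congrArg fst h)
    have h2 := valuation_congr hg (congrArg snd h)
    simp at *
    tauto
  neg3 a := rfl
  ib1 x y := ext_valuation fun g hg => by simp
  ib2 x y z := ext_valuation fun g hg => by simp; tauto
  ib2' x y z := ext_valuation fun g hg => by simp
  ib3 x y := ext_valuation fun g hg => by simp; tauto
  ib4 x y z := ext_valuation fun g hg => by simp; tauto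
  ib4' x y z := ext_valuation fun g hg => by simp; tauto
  ib5 x y := ext_valuation fun g hg => by simp; tauto
  ib6 x y z := ext_valuation fun g hg => by simp

end ProductBilattice

/-! ### The embedding `h` and generation by its image -/

section Embedding

open SimQuotient

variable {A : Type*} [ImpNegAlgebra A] [IsIAlgebra A]

@[simp] theorem fst_simEmbed (a : A) : (simEmbed a).fst = simClass a := rfl
@[simp] theorem snd_simEmbed (a : A) : (simEmbed a).snd = simClass (∼ₐa) := rfl

theorem isImpNegHom_simEmbed : IsImpNegHom (simEmbed (A := A)) where
  map_imp x y := ProductBilattice.ext_valuation fun g hg => by simp [hg.map_imp, hg.map_neg]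
  map_neg x := ProductBilattice.ext_valuation fun g hg => by simp [hg.map_neg]

theorem simEmbed_injective : Function.Injective (simEmbed (A := A)) := by
  intro a b h
  exact IsIAlgebra.eq_of_simRel (Quotient.exact (congrArg ProductBilattice.fst h))
    (Quotient.exact (congrArg ProductBilattice.snd h))

/-- A term whose value at `h(a), h(b)` is `⟨[a], [b]⟩`. -/
def pairTerm {B : Type*} [BilatticeOps B] (u v : B) : B :=
  (u ∧ₜ ((u ⊃ₐ u) ⊕ₖ ∼ₐ(u ⊃ₐ u))) ⊗ₖ ∼ₐ(v ∧ₜ ((u ⊃ₐ u) ⊕ₖ ∼ₐ(u ⊃ₐ u)))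

/-- The subterm `(u ⊃ u) ⊕ ∼ₐ(u ⊃ u)` evaluates to `⟨1, 1⟩`. Its truth meet with `h(a)` is `⟨[a],
1⟩`, and the negated truth meet with `h(b)` is `⟨1, [b]⟩`; their knowledge meet is the required
pair. -/
theorem pairTerm_simEmbed (a b : A) :
    pairTerm (simEmbed a) (simEmbed b) = ⟨simClass a, simClass b⟩ := by
  refine ProductBilattice.ext_valuation fun g hg => ?_
  simp [pairTerm]

theorem Four.desig_pairTerm (u v : Four) : (pairTerm u v).Desig ↔ u.Desig := by
  simp [pairTerm]

theorem Four.desig_neg_pairTerm (u v : Four) : (∼ₐ(pairTerm u v)).Desig ↔ v.Desig := by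
  simp [pairTerm]

theorem IsBilatticeHom.map_pairTerm {B C : Type*} [BilatticeOps B] [BilatticeOps C] {f : B → C}
    (hf : IsBilatticeHom f) (u v : B) : f (pairTerm u v) = pairTerm (f u) (f v) := by
  simp only [pairTerm, hf.map_kmeet, hf.map_tmeet, hf.map_neg, hf.map_kjoin, hf.map_imp]

theorem isGeneratedBy_range_simEmbed :
    IsGeneratedBy (ProductBilattice (SimQuotient A)) (Set.range (simEmbed (A := A))) := by
  intro S hS hsub
  refine Set.eq_univ_of_forall fun ⟨x, y⟩ => ?_
  obtain ⟨a, rfl⟩ := exists_rep x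
  obtain ⟨b, rfl⟩ := exists_rep y
  rw [← pairTerm_simEmbed]
  have ha := hsub ⟨a, rfl⟩
  have hb := hsub ⟨b, rfl⟩
  have he := hS.imp_mem _ ha _ ha
  have ht := hS.kjoin_mem _ he _ (hS.neg_mem _ he)
  exact hS.kmeet_mem _ (hS.tmeet_mem _ ha _ ht) _ (hS.neg_mem _ (hS.tmeet_mem _ hb _ ht))

end Embedding

/-! ### Implicative bilattices -/

namespace IsLatticePair

variable {α : Type*} {meet join : α → α → α} (h : IsLatticePair meet join)
include h

theorem meet_idem (x : α) : meet x x = x := by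
  conv_lhs => rw [← h.join_absorb x x]
  rw [h.join_absorb]
  have := h.meet_absorb x (meet x x)
  rwa [h.join_absorb] at this

theorem meet_eq_left_iff (x y : α) : meet x y = x ↔ join x y = y := by
  constructor
  · intro e
    rw [← e, h.join_comm, h.meet_comm x y, h.join_absorb]
  · intro e
    rw [← e, h.meet_absorb]

theorem meet_eq_of_isGLB {x y m : α} (h1 : meet m x = m) (h2 : meet m y = m)
    (h3 : ∀ z, meet z x = z → meet z y = z → meet z m = z) : meet x y = m := by
  have e1 : meet (meet x y) m = meet x y := by
    refine h3 _ ?_ ?_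
    · rw [h.meet_comm x y, h.meet_assoc, h.meet_idem]
    · rw [h.meet_assoc, h.meet_idem]
  rw [← e1, h.meet_comm, ← h.meet_assoc, h1, h2]

theorem meet_meet_left (x y : α) : meet (meet x y) x = meet x y := by
  rw [h.meet_comm x y, h.meet_assoc, h.meet_idem]

theorem meet_meet_right (x y : α) : meet (meet x y) y = meet x y := by
  rw [h.meet_assoc, h.meet_idem]

end IsLatticePair

namespace IsImplicativeBilattice

variable {B : Type*} [BilatticeOps B] [IsImplicativeBilattice B]

theorem tmeet_comm (x y : B) : x ∧ₜ y = y ∧ₜ x := tlattice.meet_comm x y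

theorem ePred_self_imp (x : B) : EPred (x ⊃ₐ x) := (ib1 _ _).symm

theorem imp_eq_of_ePred {e : B} (h : EPred e) (y : B) : e ⊃ₐ y = y := by
  rw [EPred] at h; rw [h, ib1]

theorem imp_left_comm (x y z : B) : x ⊃ₐ (y ⊃ₐ z) = y ⊃ₐ (x ⊃ₐ z) := by
  rw [ib2, tmeet_comm, ← ib2]

/-- Since `e ⊃ w = w`, Peirce's law for `e` and `w` collapses to `(w ⊃ e) ⊃ e = e`. -/
theorem ePred_imp_of_ePred {e : B} (h : EPred e) (w : B) : EPred (w ⊃ₐ e) := by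
  have h3 : (w ⊃ₐ e) ⊃ₐ e = e := by
    have := ib3 e w
    rwa [imp_eq_of_ePred h, imp_eq_of_ePred h] at this
  rw [EPred, imp_left_comm, h3]

theorem ePred_weaken (x y : B) : EPred (x ⊃ₐ (y ⊃ₐ x)) := by
  rw [imp_left_comm]; exact ePred_imp_of_ePred (ePred_self_imp x) y

theorem ePred_of_tle {x y : B} (h : x ∧ₜ y = x) : EPred (x ⊃ₐ y) := by
  rw [← h, ← ib2]; exact ePred_imp_of_ePred (ePred_self_imp y) x

theorem tle_kmeet_of_ePred {a b : B} (h : EPred (a ⊃ₐ b)) : a ∧ₜ (a ⊗ₖ b) = a := by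
  have := ib5 a b
  rwa [imp_eq_of_ePred h] at this

/-- (IB5) gives `a = a ∧ (a ⊗ b)`. As an antecedent this curries to `a`, `a`, `b`, and the repeated
`a` is absorbed. -/
theorem imp_imp_of_ePred {a b : B} (h : EPred (a ⊃ₐ b)) (z : B) : a ⊃ₐ (b ⊃ₐ z) = a ⊃ₐ z := by
  conv_rhs => rw [← tle_kmeet_of_ePred h, ← ib2, ← ib2', ← ib2, ib2, tlattice.meet_idem]

theorem ePred_imp_trans {a b c : B} (h : EPred (a ⊃ₐ b)) (h' : EPred (b ⊃ₐ c)) :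
    EPred (a ⊃ₐ c) := by
  rw [← imp_imp_of_ePred h]
  exact ePred_imp_of_ePred h' a

theorem imp_congr_of_ePred {a b : B} (h : EPred (a ⊃ₐ b)) (h' : EPred (b ⊃ₐ a)) (z : B) :
    a ⊃ₐ z = b ⊃ₐ z := by
  rw [← imp_imp_of_ePred h, imp_left_comm, imp_imp_of_ePred h']

theorem ePred_imp_tmeet {a x y : B} (h : EPred (a ⊃ₐ x)) (h' : EPred (a ⊃ₐ y)) :
    EPred (a ⊃ₐ (x ∧ₜ y)) := by
  rw [← imp_imp_of_ePred h, ← imp_imp_of_ePred h', imp_left_comm y, ib2 x]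
  exact ePred_imp_of_ePred (ePred_self_imp _) a

/-- After currying, the antecedents are `x ∧ y` and `x ∧ (x ⊃ y)`. They entail each other; the
nontrivial direction is modus ponens, which is (IB5). -/
theorem imp_self_distrib (x y z : B) : x ⊃ₐ (y ⊃ₐ z) = (x ⊃ₐ y) ⊃ₐ (x ⊃ₐ z) := by
  rw [imp_left_comm (x ⊃ₐ y), ib2, ib2 x (x ⊃ₐ y)]
  refine imp_congr_of_ePred (ePred_imp_tmeet ?_ ?_) ?_ z
  · exact ePred_of_tle (tlattice.meet_meet_left x y)
  · rw [← ib2]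
    exact ePred_imp_of_ePred (ePred_weaken y x) x
  · refine ePred_imp_trans (b := x ⊗ₖ y) ?_ ?_
    · rw [← ib2]
      exact ePred_of_tle (ib5 x y)
    · rw [← ib2']
      exact ePred_self_imp _

instance isWeakIAlgebra : IsWeakIAlgebra B where
  i1 := ib1
  i2 := imp_self_distrib
  i2' := imp_left_comm
  i3 := ib3
  i4 x y z := by rw [ib2, ib6]
  i5 x := (neg3 x).symm

theorem neg_neg (x : B) : ∼ₐ∼ₐx = x := (neg3 x).symm

theorem neg_tjoin (x y : B) : ∼ₐ(x ∨ₜ y) = ∼ₐx ∧ₜ ∼ₐy := by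
  have hle : ∀ a b : B, ∼ₐb ∧ₜ ∼ₐa = ∼ₐb ↔ a ∨ₜ b = b := fun a b => by
    rw [← tlattice.meet_eq_left_iff]
    refine ⟨fun h => ?_, neg1 a b⟩
    have := neg1 _ _ h
    rwa [neg_neg, neg_neg] at this
  symm
  refine tlattice.meet_eq_of_isGLB ?_ ?_ fun z hx hy => ?_
  · rw [hle, ← tlattice.meet_eq_left_iff, tlattice.meet_absorb]
  · rw [hle, ← tlattice.meet_eq_left_iff, tlattice.join_comm, tlattice.meet_absorb]
  · rw [← neg_neg z, hle] at *
    rw [tlattice.join_assoc, hy, hx]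

theorem neg_tmeet (x y : B) : ∼ₐ(x ∧ₜ y) = ∼ₐx ∨ₜ ∼ₐy := by
  rw [← neg_neg (∼ₐx ∨ₜ ∼ₐy), neg_tjoin, neg_neg, neg_neg]

theorem neg_kmeet (x y : B) : ∼ₐ(x ⊗ₖ y) = ∼ₐx ⊗ₖ ∼ₐy := by
  symm
  refine klattice.meet_eq_of_isGLB (neg2 _ _ (klattice.meet_meet_left x y))
    (neg2 _ _ (klattice.meet_meet_right x y)) fun z hx hy => ?_
  have h1 := neg2 _ _ hx
  have h2 := neg2 _ _ hy
  rw [neg_neg] at h1 h2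
  have := neg2 (∼ₐz) (x ⊗ₖ y) (by rw [← klattice.meet_assoc, h1, h2])
  rwa [neg_neg] at this

theorem neg_kjoin (x y : B) : ∼ₐ(x ⊕ₖ y) = ∼ₐx ⊕ₖ ∼ₐy := by
  have hle : ∀ a b : B, a ⊕ₖ b = b → ∼ₐa ⊕ₖ ∼ₐb = ∼ₐb := fun a b h =>
    (klattice.meet_eq_left_iff _ _).1 (neg2 a b ((klattice.meet_eq_left_iff _ _).2 h))
  have hl : ∀ a b : B, a ⊕ₖ (a ⊕ₖ b) = a ⊕ₖ b := fun a b => by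
    rw [← klattice.meet_eq_left_iff, klattice.meet_absorb]
  have half : ∀ a b : B, (∼ₐa ⊕ₖ ∼ₐb) ⊕ₖ ∼ₐ(a ⊕ₖ b) = ∼ₐ(a ⊕ₖ b) := fun a b => by
    rw [klattice.join_assoc, hle b, hle a _ (hl a b)]
    rw [klattice.join_comm a b, hl]
  have h1 := half x y
  -- The opposite inequality is the same bound at the negated arguments, negated once more.
  have h2 := hle _ _ (half (∼ₐx) (∼ₐy))
  rw [neg_neg, neg_neg, neg_neg] at h2
  rw [← h1, klattice.join_comm]
  exact h2

/-- This replaces (I6). By (IB5), `E(a ⊃ b)` gives `a ≤ a ⊗ b` in the truth order, while `E(∼ₐa ⊃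
∼ₐb)` gives the reverse after negation. So `a = a ⊗ b`, and symmetrically for `b`. -/
theorem eq_of_simRel {a b : B} (h : SimRel a b) (h' : SimRel (∼ₐa) (∼ₐb)) : a = b := by
  have key : ∀ {a b : B}, EPred (a ⊃ₐ b) → EPred (∼ₐa ⊃ₐ ∼ₐb) → a = a ⊗ₖ b := by
    intro a b h h'
    have h1 := tle_kmeet_of_ePred h
    have h2 := tle_kmeet_of_ePred h'
    rw [← neg_kmeet] at h2
    have h3 := neg1 _ _ h2
    rw [neg_neg, neg_neg] at h3
    exact h1.symm.trans ((tmeet_comm _ _).trans h3)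
  rw [key h.1 h'.1, klattice.meet_comm, ← key h.2 h'.2]

theorem eq_of_forall_hom {a b : B} (h : ∀ g : B → Four, IsImpNegHom g → g a = g b) : a = b := by
  refine eq_of_simRel ((simRel_iff_forall_hom _ _).2 fun g hg => ?_)
    ((simRel_iff_forall_hom _ _).2 fun g hg => ?_)
  · rw [h g hg]
  · rw [hg.map_neg, hg.map_neg, h g hg]

theorem isBilatticeHom_of_isImpNegHom {g : B → Four} (hg : IsImpNegHom g) : IsBilatticeHom g := by
  have himp : ∀ {x y : B}, EPred (x ⊃ₐ y) → (g x).Desig → (g y).Desig := fun h => by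
    have := hg.desig_of_ePred h
    rwa [hg.map_imp, Four.desig_imp] at this
  have htm : ∀ x y : B, (g (x ∧ₜ y)).Desig ↔ (g x).Desig ∧ (g y).Desig := fun x y => by
    refine ⟨fun h => ⟨himp (ePred_of_tle (tlattice.meet_meet_left x y)) h,
      himp (ePred_of_tle (tlattice.meet_meet_right x y)) h⟩, fun h => ?_⟩
    have := hg.desig_of_ePred (ePred_self_imp (x ∧ₜ y))
    rw [← ib2, hg.map_imp, hg.map_imp, Four.desig_imp, Four.desig_imp] at this
    exact this h.1 h.2
  have hkm : ∀ x y : B, (g (x ⊗ₖ y)).Desig ↔ (g x).Desig ∧ (g y).Desig := fun x y => by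
    rw [← htm]
    refine ⟨himp ?_, himp ?_⟩
    · rw [← ib2']; exact ePred_self_imp _
    · rw [ib2']; exact ePred_self_imp _
  -- (IB4) characterises disjunction: `z = j` shows that `x` and `y` each force `j`, and when
  -- neither is designated `z = x` shows that `j` is not.
  have joinOr : ∀ x y j : B, (∀ z, j ⊃ₐ z = (x ⊃ₐ z) ∧ₜ (y ⊃ₐ z)) →
      ((g j).Desig ↔ (g x).Desig ∨ (g y).Desig) := by
    intro x y j hj
    have hz : ∀ z, ((g j).Desig → (g z).Desig) ↔
        ((g x).Desig → (g z).Desig) ∧ ((g y).Desig → (g z).Desig) := fun z => by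
      have := htm (x ⊃ₐ z) (y ⊃ₐ z)
      rw [← hj] at this
      simpa [hg.map_imp] using this
    have h1 := hz j
    have h2 := hz x
    have h3 := hz y
    tauto
  have htj := fun x y : B => joinOr x y (x ∨ₜ y) (ib4 x y)
  have hkj := fun x y : B => joinOr x y (x ⊕ₖ y) fun z => (ib4' x y z).symm
  refine ⟨hg, ?_, ?_, ?_, ?_⟩ <;> intro x y <;> rw [Four.eq_iff]
  · rw [← hg.map_neg, neg_tmeet]
    simp [htm, htj, hg.map_neg]
  · rw [← hg.map_neg, neg_tjoin]
    simp [htm, htj, hg.map_neg]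
  · rw [← hg.map_neg, neg_kmeet]
    simp [hkm, hg.map_neg]
  · rw [← hg.map_neg, neg_kjoin]
    simp [hkj, hg.map_neg]

end IsImplicativeBilattice

/-! ### The universal property -/

section UniversalProperty

open SimQuotient

variable {A : Type*} [ImpNegAlgebra A] [IsIAlgebra A] {B : Type*} [BilatticeOps B]

/-- The extension to `A/∼ ⊙ A/∼` of a homomorphism from `A`. -/
noncomputable def simLift (f : A → B) (p : ProductBilattice (SimQuotient A)) : B :=
  pairTerm (f (Quotient.out p.fst)) (f (Quotient.out p.snd))

theorem valuation_eq_desig_out {g : A → Four} (hg : IsImpNegHom g) (x : SimQuotient A) :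
    valuation hg x ↔ (g (Quotient.out x)).Desig := by
  rw [← valuation_simClass hg]
  exact valuation_congr hg (Quotient.out_eq x).symm

variable [IsImplicativeBilattice B] {f : A → B} (hf : IsImpNegHom f)

/-- Seen through `g`, the lift depends only on the classes in `p`, so the chosen representatives
disappear from all later computations. -/
theorem desig_simLift {g : B → Four} (hg : IsImpNegHom g)
    (p : ProductBilattice (SimQuotient A)) :
    (g (simLift f p)).Desig ↔ valuation (hg.comp hf) p.fst := by
  rw [simLift, (IsImplicativeBilattice.isBilatticeHom_of_isImpNegHom hg).map_pairTerm,
    Four.desig_pairTerm, valuation_eq_desig_out]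
  rfl

theorem desig_neg_simLift {g : B → Four} (hg : IsImpNegHom g)
    (p : ProductBilattice (SimQuotient A)) :
    (∼ₐ(g (simLift f p))).Desig ↔ valuation (hg.comp hf) p.snd := by
  rw [simLift, (IsImplicativeBilattice.isBilatticeHom_of_isImpNegHom hg).map_pairTerm,
    Four.desig_neg_pairTerm, valuation_eq_desig_out]
  rfl

include hf

theorem isBilatticeHom_simLift : IsBilatticeHom (simLift f) := by
  refine ⟨⟨?_, ?_⟩, ?_, ?_, ?_, ?_⟩ <;> intros <;>
    refine IsImplicativeBilattice.eq_of_forall_hom fun g hg => ?_ <;>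
    have hg' := IsImplicativeBilattice.isBilatticeHom_of_isImpNegHom hg <;>
    rw [Four.eq_iff] <;>
    simp [hg'.map_imp, hg'.map_neg, hg'.map_tmeet, hg'.map_tjoin, hg'.map_kmeet, hg'.map_kjoin,
      desig_simLift hf hg, desig_neg_simLift hf hg]

theorem simLift_comp_simEmbed : simLift f ∘ simEmbed = f := by
  funext a
  refine IsImplicativeBilattice.eq_of_forall_hom fun g hg => ?_
  rw [Four.eq_iff, Function.comp_apply, desig_simLift hf hg, desig_neg_simLift hf hg]
  simp [hf.map_neg, hg.map_neg]

omit [IsImplicativeBilattice B] hf in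
theorem simEmbed_hom_ext {g g' : ProductBilattice (SimQuotient A) → B} (hg : IsBilatticeHom g)
    (hg' : IsBilatticeHom g') (h : g ∘ simEmbed = g' ∘ simEmbed) : g = g' := by
  funext ⟨x, y⟩
  obtain ⟨a, rfl⟩ := exists_rep x
  obtain ⟨b, rfl⟩ := exists_rep y
  rw [← pairTerm_simEmbed, hg.map_pairTerm, hg'.map_pairTerm]
  exact congrArg₂ pairTerm (congrFun h a) (congrFun h b)

/-- `E` is an equation in `⊃`, so an injective `f` reflects it and hence reflects `∼`. The
valuations induced by the composites `g ∘ f` therefore already separate the points of the quotient.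
-/
theorem simLift_injective (hinj : Function.Injective f) : Function.Injective (simLift f) := by
  have key : ∀ x y : SimQuotient A,
      (∀ (g : B → Four) (hg : IsImpNegHom g),
        valuation (hg.comp hf) x ↔ valuation (hg.comp hf) y) → x = y := by
    intro x y h
    obtain ⟨a, rfl⟩ := exists_rep x
    obtain ⟨b, rfl⟩ := exists_rep y
    have hs : SimRel (f a) (f b) := (simRel_iff_forall_hom _ _).2 h
    have reflect : ∀ {c d : A}, EPred (f c ⊃ₐ f d) → EPred (c ⊃ₐ d) := fun h => by
      apply hinj
      rw [EPred] at h
      rw [hf.map_imp, hf.map_imp, hf.map_imp]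
      exact h
    exact Quotient.sound ⟨reflect hs.1, reflect hs.2⟩
  intro p q hpq
  refine ProductBilattice.ext (key _ _ fun g hg => ?_) (key _ _ fun g hg => ?_)
  · rw [← desig_simLift hf hg, ← desig_simLift hf hg, hpq]
  · rw [← desig_neg_simLift hf hg, ← desig_neg_simLift hf hg, hpq]

end UniversalProperty

/-! ### The variety generated by the reduct of `FOUR⊃` -/

theorem IsImpNegHom.map_eval {A B : Type*} [ImpNegAlgebra A] [ImpNegAlgebra B] {f : A → B}
    (hf : IsImpNegHom f) (e : ℕ → A) (s : ImpNegTerm) : f (s.eval e) = s.eval (f ∘ e) := by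
  induction s with
  | var n => rfl
  | imp s t hs ht => simp only [ImpNegTerm.eval, hf.map_imp, hs, ht]
  | neg s hs => simp only [ImpNegTerm.eval, hf.map_neg, hs]

theorem InHSP.satisfiesEq {C : Type w} [ImpNegAlgebra C] {A : Type u} [ImpNegAlgebra A]
    (h : InHSP C A) {s t : ImpNegTerm} (hst : SatisfiesEq C s t) : SatisfiesEq A s t := by
  obtain ⟨I, D, _, g, q, hg, hinj, hq, hsurj⟩ := h
  intro e
  -- The assignment lifts along the surjection `q`; in `D` the equation is checked coordinatewise in
  -- the power.
  obtain ⟨r, hr⟩ := hsurj.hasRightInverse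
  have he : e = q ∘ (r ∘ e) := funext fun n => (hr (e n)).symm
  rw [he, ← hq.map_eval, ← hq.map_eval]
  congr 1
  apply hinj
  funext i
  have hgi : IsImpNegHom fun d => g d i :=
    ⟨fun x y => congrFun (hg.map_imp x y) i, fun x => congrFun (hg.map_neg x) i⟩
  exact (hgi.map_eval _ s).trans ((hst _).trans (hgi.map_eval _ t).symm)

/-- Evaluation at all homomorphisms to `Four` embeds `A` in a power, so no proper quotient is
needed. -/
theorem IsIAlgebra.inHSP_four {A : Type u} [ImpNegAlgebra A] [IsIAlgebra A] : InHSP Four A :=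
  ⟨{g : A → Four // IsImpNegHom g}, A, inferInstance, fun a g => g.1 a, id,
    ⟨fun x y => funext fun g => g.2.map_imp x y, fun x => funext fun g => g.2.map_neg x⟩,
    fun _ _ h => eq_of_forall_hom fun g hg => congrFun h ⟨g, hg⟩,
    ⟨fun _ _ => rfl, fun _ => rfl⟩, Function.surjective_id⟩

theorem isIAlgebra_of_satisfiesEq {A : Type*} [ImpNegAlgebra A]
    (h : ∀ s t : ImpNegTerm, SatisfiesEq Four s t → SatisfiesEq A s t) : IsIAlgebra A := by
  let e : A → A → A → ℕ → A := fun x y z n => if n = 0 then x else if n = 1 then y else z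
  let X := ImpNegTerm.var 0
  let Y := ImpNegTerm.var 1
  let Z := ImpNegTerm.var 2
  have four := Four.isIAlgebra
  refine ⟨fun x y => ?_, fun x y z => ?_, fun x y z => ?_, fun x y => ?_, fun x y z => ?_,
    fun x => ?_, fun x y => ?_⟩
  · exact h (.imp (.imp X X) Y) Y (fun _ => four.i1 _ _) (e x y y)
  · exact h (.imp X (.imp Y Z)) (.imp (.imp X Y) (.imp X Z)) (fun _ => four.i2 _ _ _) (e x y z)
  · exact h (.imp X (.imp Y Z)) (.imp Y (.imp X Z)) (fun _ => four.i2' _ _ _) (e x y z)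
  · exact h (.imp (.imp (.imp X Y) X) X) (.imp X X) (fun _ => four.i3 _ _) (e x y y)
  · exact h (.imp X (.imp (.neg Y) Z)) (.imp (.neg (.imp X Y)) Z) (fun _ => four.i4 _ _ _)
      (e x y z)
  · exact h (.neg (.neg X)) X (fun _ => four.i5 _) (e x x x)
  · let P : ImpNegTerm → ImpNegTerm := fun U =>
      .imp (.imp X Y) (.imp (.imp Y X)
        (.imp (.imp (.neg X) (.neg Y)) (.imp (.imp (.neg Y) (.neg X)) U)))
    exact h (P X) (P Y) (fun _ => four.i6 _ _) (e x y y)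

theorem theoremt :
    (∀ (A : Type u) [Nonempty A] [ImpNegAlgebra A] [IsIAlgebra A],
      -- the factor of the product is a Tarski algebra and a classical implicative lattice
      IsTarski (simImp (A := A)) ∧
      IsClassicalImplicativeLattice (SimQuotient A) ∧
      -- the product is an implicative bilattice, and `h` embeds `A` into it
      IsImplicativeBilattice (ProductBilattice (SimQuotient A)) ∧
      IsImpNegHom (simEmbed (A := A)) ∧
      Function.Injective (simEmbed (A := A)) ∧
      -- it is generated by the image of `h`
      IsGeneratedBy (ProductBilattice (SimQuotient A)) (Set.range (simEmbed (A := A))) ∧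
      -- the universal property
      (∀ (B : Type v) [BilatticeOps B] [IsImplicativeBilattice B] (f : A → B), IsImpNegHom f →
        ∃ f' : ProductBilattice (SimQuotient A) → B,
          IsBilatticeHom f' ∧ f' ∘ simEmbed = f ∧
          (∀ g : ProductBilattice (SimQuotient A) → B,
            IsBilatticeHom g → g ∘ simEmbed = f → g = f') ∧
          (Function.Injective f → Function.Injective f'))) ∧
    -- `FOUR⊃` is an implicative bilattice and its reduct generates the variety of I-algebras
    IsImplicativeBilattice Four ∧
    (∀ (A : Type u) [Nonempty A] [ImpNegAlgebra A],
      (IsIAlgebra A ↔ InHSP Four A) ∧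
      (IsIAlgebra A ↔
        ∀ s t : ImpNegTerm, SatisfiesEq Four s t → SatisfiesEq A s t)) := by
  refine ⟨fun A _ _ _ => ⟨SimQuotient.isTarski, SimQuotient.isClassicalImplicativeLattice,
    ProductBilattice.isImplicativeBilattice, isImpNegHom_simEmbed, simEmbed_injective,
    isGeneratedBy_range_simEmbed, fun B _ _ f hf => ⟨simLift f, isBilatticeHom_simLift hf,
      simLift_comp_simEmbed hf, fun g hg hgf => ?_, simLift_injective hf⟩⟩,
    Four.isImplicativeBilattice, fun A _ _ => ?_⟩
  · exact simEmbed_hom_ext hg (isBilatticeHom_simLift hf)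
      (hgf.trans (simLift_comp_simEmbed hf).symm)
  · have h1 : IsIAlgebra A → InHSP Four A := fun _ => IsIAlgebra.inHSP_four
    have h2 : InHSP Four A → ∀ s t : ImpNegTerm, SatisfiesEq Four s t → SatisfiesEq A s t :=
      fun h _ _ => h.satisfiesEq
    exact ⟨⟨h1, fun h => isIAlgebra_of_satisfiesEq (h2 h)⟩,
      ⟨fun h => h2 (h1 h), isIAlgebra_of_satisfiesEq⟩⟩
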